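/- Let $c\ge 1$, let $r,s$ be positive integers with $d=\gcd(r,s)$, and let $G=\mathbb Z_r\oplus\mathbb Z_s$ be the direct sum of the cyclic groups of orders $r$ and $s$. Let $1\to R\to F\to G\to 1$ be any free presentation of $G$ (an exact sequence with $F$ a free group), write $\gamma_1(F)=F$, $\gamma_{k+1}(F)=[\gamma_k(F),F]$ and $[R,\,_0F]=R$, $[R,\,_{k+1}F]=[[R,\,_kF],F]$, and let $$\mathcal N_cM(G)=\frac{R\cap\gamma_{c+1}(F)}{[R,\,_cF]}$$ be the Baer invariant of $G$ with respect to the variety $\mathcal N_c$ of nilpotent groups of class at most $c$. Then $$\mathcal N_cM(G)\;\cong\;\underbrace{\mathbb Z_d\oplus\mathbb Z_d\oplus\cdots\oplus\mathbb Z_d}_{n\text{ copies}},$$ where $n$ is the number of basic commutators of weight $c+1$ on two letters. Here basic commutators are formal bracketings of the letters, whose weight is the number of letters occurring in them (with multiplicity), and which are linearly ordered so that those of smaller weight come first (the order within each weight being arbitrary): every letter is a basic commutator of weight $1$, and a bracketing $[u,v]$ is a basic commutator if and only if $u$ and $v$ are basic commutators, $u>v$, and, in case $u=[a,b]$, also $b\le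 v$. -/

import Mathlib

universe u v

/-- The subgroup `[R, _c F] = [R, F, …, F]` (left-normed, with `c` entries `F`). -/
def iteratedCommutator {F : Type u} [Group F] (R : Subgroup F) : ℕ → Subgroup F
  | 0 => R
  | c + 1 => ⁅iteratedCommutator R c, (⊤ : Subgroup F)⁆

instance iteratedCommutator_normal {F : Type u} [Group F] (R : Subgroup F) [R.Normal] (c : ℕ) :
    (iteratedCommutator R c).Normal := by
  induction c with
  | zero => assumption
  | succ c ih => exact Subgroup.commutator_normal _ _

/-- For normal `R`, the subgroup `[R, _c F]` lies in `R ∩ γ_{c+1}(F)`, so that the quotient below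
is the honest one. -/
theorem iteratedCommutator_le {F : Type u} [Group F] (R : Subgroup F) [R.Normal] (c : ℕ) :
    iteratedCommutator R c ≤ R ⊓ (⊤ : Subgroup F).lowerCentralSeries c := by
  induction c with
  | zero => exact le_inf le_rfl le_top
  | succ c ih =>
    refine le_inf ?_ (Subgroup.commutator_mono (ih.trans inf_le_right) le_rfl)
    exact (Subgroup.commutator_mono (ih.trans inf_le_left) le_rfl).trans
      (Subgroup.commutator_le_left R ⊤)

/-- The Baer invariant `(R ∩ γ_{c+1}(F)) / [R, _c F]`, where `R = ker π`, of a group `G` presented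
by `π : F →* G`, with respect to the variety of nilpotent groups of class at most `c`.
Mathlib's lower central series starts at index `0`: `γ_{c+1}(F)` is its term of index `c`. -/
abbrev NilpotentBaerInvariant (c : ℕ) {F : Type u} {G : Type v} [Group F] [Group G]
    (π : F →* G) : Type u :=
  ↥(π.ker ⊓ (⊤ : Subgroup F).lowerCentralSeries c) ⧸
    (iteratedCommutator π.ker c).subgroupOf (π.ker ⊓ (⊤ : Subgroup F).lowerCentralSeries c)

/-- Basic commutators on the letters `α`, as formal bracketings, `u * v` standing for `[u, v]`,
with respect to an order on bracketings: every letter is basic, and `[u, v]` is basic if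
`u` and `v` are basic, `u > v`, and moreover `b ≤ v` in case `u = [a, b]`. -/
def IsBasicCommutator {α : Type u} [LinearOrder (FreeMagma α)] : FreeMagma α → Prop
  | .of _ => True
  | .mul u v => IsBasicCommutator u ∧ IsBasicCommutator v ∧ v < u ∧
      ∀ a b : FreeMagma α, u = a * b → b ≤ v

/-- The basic commutators of weight `n`. -/
def basicCommutators (α : Type u) [LinearOrder (FreeMagma α)] (n : ℕ) : Set (FreeMagma α) :=
  {w | IsBasicCommutator w ∧ w.length = n}

/-- There are only finitely many basic commutators of given weight on a finite set of letters, so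
that their number, as a natural number, is the honest one. -/
theorem basicCommutators_finite (α : Type u) [Finite α] [LinearOrder (FreeMagma α)] (n : ℕ) :
    (basicCommutators α n).Finite := by
  have key : ∀ n : ℕ, {w : FreeMagma α | w.length ≤ n}.Finite := by
    intro n
    induction n with
    | zero =>
      refine Set.finite_empty.subset ?_
      intro w hw
      have h1 := w.length_pos
      have h2 : w.length ≤ 0 := hw
      omega
    | succ n ih =>
      refine ((Set.finite_range (FreeMagma.of : α → FreeMagma α)).union
        (Set.Finite.image2 (fun a b => a * b) ih ih)).subset ?_
      intro w hw
      cases w with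
      | of x => exact Or.inl ⟨x, rfl⟩
      | mul a b =>
        have h1 := a.length_pos
        have h2 := b.length_pos
        have h3 : a.length + b.length ≤ n + 1 := hw
        refine Or.inr ⟨a, ?_, b, ?_, rfl⟩ <;> simp only [Set.mem_ofPred_eq] <;> omega
  exact (key n).subset fun w hw => hw.2.le

/-!
Write `R = ker π`, `G = ℤ/r ⊕ ℤ/s` and `d = gcd r s`. As `G` is abelian and `c ≥ 1`, the Baer
invariant is `Q = γ_{c+1}(F) / [R, _c F]`. It is an abelian group, since `γ_{c+2}(F) ≤ [R, _c F]`.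
The proof exhibits the basic commutators of weight `c + 1`, evaluated at lifts `x 0`, `x 1 ∈ F` of
the two generators of `G`, as a basis of `Q` over `ℤ/d`. It works with the given presentation
throughout and does not use that `Q` is independent of it.

*Generation* (`lowerCentralSeries_le_basicSubgroup`). The three subgroups lemma gives
`[γ_i(F), [R, _{j-1} F]] ≤ [R, _{i+j-1} F]`, so that the brackets
`γ_i(F) × γ_j(F) → γ_{i+j}(F) / [R, _{i+j-1} F]` obey the laws of a Lie ring which is generated by
`x 0` and `x 1`. The Jacobi identity rewrites each bracket of basic commutators as a combination of
basic commutators.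

*Exponent* (`pow_mem_iteratedCommutator`). For `g ∈ γ_c(F)`, `[g, f] ^ n = [g ^ n, f]` modulo
`[R, _c F]`, which reduces the claim to weight two. There `[x 0, x 1]` is killed both by `r` and
by `s`, because `x 0 ^ r` and `x 1 ^ s` belong to `R`.

*Independence.* Let `A` be the free associative algebra over `ℤ/d` on two letters. As `F` is free,
there is a homomorphism `Φ : F → A⟦X⟧ˣ` with `Φ g ≡ 1 + X ℓ(π g)` modulo `X ^ 2`, where `ℓ : G → A`
sends the generators to the letters. It takes `R` to units congruent to `1` modulo `X ^ 2`, hence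
`[R, _c F]` to units congruent to `1` modulo `X ^ (c + 2)`; and the coefficient of `X ^ (c + 1)`
defines a homomorphism `Q → A` which sends every basic commutator to the corresponding Lie
polynomial (`coeff_commutatorEval`). These polynomials are linearly independent over any commutative
ring (`linearIndependent_lieEval`). For this, the basic commutators are eliminated one after the
other, à la Lazard: products of nonincreasing sequences of basic commutators span all words, and
their number does not exceed the number of words of the same weight
(`standardSpan_and_embedding`), so by the Orzech property they are independent.
-/

open scoped commutatorElement

/-! ### Commutator subgroups modulo a normal subgroup -/

namespace Subgroup

variable {F : Type u} [Group F]

theorem commutator_le_iff_map_eq_bot {K : Subgroup F} [K.Normal] {A B : Subgroup F} :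
    ⁅A, B⁆ ≤ K ↔ ⁅A.map (QuotientGroup.mk' K), B.map (QuotientGroup.mk' K)⁆ = ⊥ := by
  rw [← map_commutator, map_eq_bot_iff, QuotientGroup.ker_mk']

/-- The three subgroups lemma modulo a normal subgroup. -/
theorem commutator_commutator_le_of_rotate {K : Subgroup F} [K.Normal] {A B C : Subgroup F}
    (h₁ : ⁅⁅B, C⁆, A⁆ ≤ K) (h₂ : ⁅⁅C, A⁆, B⁆ ≤ K) : ⁅⁅A, B⁆, C⁆ ≤ K := by
  rw [commutator_le_iff_map_eq_bot, map_commutator] at *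
  exact commutator_commutator_eq_bot_of_rotate h₁ h₂

theorem commutator_closure_le {K : Subgroup F} [K.Normal] {S T : Set F}
    (h : ∀ s ∈ S, ∀ t ∈ T, ⁅s, t⁆ ∈ K) : ⁅closure S, closure T⁆ ≤ K := by
  rw [commutator_le_iff_map_eq_bot, commutator_eq_bot_iff_le_centralizer, MonoidHom.map_closure,
    MonoidHom.map_closure, centralizer_closure, closure_le]
  rintro _ ⟨s, hs, rfl⟩
  rw [SetLike.mem_coe]
  rintro _ ⟨t, ht, rfl⟩
  rw [eq_comm, ← commutatorElement_eq_one_iff_mul_comm, ← map_commutatorElement,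
    QuotientGroup.mk'_apply, QuotientGroup.eq_one_iff]
  exact h s hs t ht

end Subgroup

/-! ### The series `[R, _k F]` -/

section Series

variable {F : Type u} [Group F]

theorem iteratedCommutator_top (k : ℕ) :
    iteratedCommutator (⊤ : Subgroup F) k = (⊤ : Subgroup F).lowerCentralSeries k := by
  induction k with
  | zero => rfl
  | succ k ih => rw [iteratedCommutator, ih]; rfl

/-- In terms of `γ_{i+1} = lowerCentralSeries i`, this is
`[γ_{i+1}(F), [R, _j F]] ≤ [R, _{i+j+1} F]`. -/
theorem commutator_lowerCentralSeries_iteratedCommutator_le (R : Subgroup F) [R.Normal]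
    (i j : ℕ) :
    ⁅(⊤ : Subgroup F).lowerCentralSeries i, iteratedCommutator R j⁆ ≤
      iteratedCommutator R (i + j + 1) := by
  induction i generalizing j with
  | zero =>
    rw [Subgroup.commutator_comm, zero_add]
    exact le_rfl
  | succ i ih =>
    refine Subgroup.commutator_commutator_le_of_rotate ?_ ?_
    · rw [Subgroup.commutator_comm ⊤, Subgroup.commutator_comm]
      exact (ih (j + 1)).trans (by rw [show i + (j + 1) + 1 = i + 1 + j + 1 by omega])
    · rw [Subgroup.commutator_comm (iteratedCommutator R j)]
      refine (Subgroup.commutator_mono (ih j) le_rfl).trans ?_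
      rw [show i + 1 + j + 1 = i + j + 1 + 1 by omega]
      exact le_rfl

theorem lowerCentralSeries_succ_le_iteratedCommutator {R : Subgroup F}
    (hR : ⁅(⊤ : Subgroup F), ⊤⁆ ≤ R) (k : ℕ) :
    (⊤ : Subgroup F).lowerCentralSeries (k + 1) ≤ iteratedCommutator R k := by
  induction k with
  | zero => exact hR
  | succ k ih => exact Subgroup.commutator_mono ih le_rfl

end Series

/-! ### Generation of `γ_n(F)` modulo `[R, _{n-1} F]` by basic commutators -/

section Spanning

variable {α : Type v} {F : Type u} [Group F]

/-- The value in a group of a formal bracketing, the letters being sent to the elements `x i`. -/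
def commutatorEval (x : α → F) : FreeMagma α → F
  | .of i => x i
  | .mul a b => ⁅commutatorEval x a, commutatorEval x b⁆

theorem commutatorEval_mul (x : α → F) (a b : FreeMagma α) :
    commutatorEval x (a * b) = ⁅commutatorEval x a, commutatorEval x b⁆ := rfl

theorem FreeMagma.length_mul' (a b : FreeMagma α) : (a * b).length = a.length + b.length := rfl

theorem commutatorEval_mem (x : α → F) (w : FreeMagma α) {n : ℕ} (hn : w.length = n + 1) :
    commutatorEval x w ∈ (⊤ : Subgroup F).lowerCentralSeries n := by
  induction w generalizing n with
  | ih1 i =>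
    have : n = 0 := by
      change 1 = n + 1 at hn
      omega
    subst this
    exact Subgroup.mem_top _
  | ih2 a b iha ihb =>
    obtain ⟨i, hi⟩ := Nat.exists_eq_add_one.2 a.length_pos
    obtain ⟨j, hj⟩ := Nat.exists_eq_add_one.2 b.length_pos
    rw [FreeMagma.length_mul'] at hn
    have h := commutator_lowerCentralSeries_iteratedCommutator_le (⊤ : Subgroup F) i j
    rw [iteratedCommutator_top, iteratedCommutator_top, show i + j + 1 = n by omega] at h
    exact h (Subgroup.commutator_mem_commutator (iha hi) (ihb hj))

section

variable [LinearOrder (FreeMagma α)]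

theorem isBasicCommutator_mul {a b : FreeMagma α} :
    IsBasicCommutator (a * b) ↔ IsBasicCommutator a ∧ IsBasicCommutator b ∧ b < a ∧
      ∀ a' b' : FreeMagma α, a = a' * b' → b' ≤ b := Iff.rfl

theorem isBasicCommutator_of (i : α) : IsBasicCommutator (FreeMagma.of i) := trivial

/-- The subgroup generated by `[R, _{n-1} F]` and the values of the basic commutators of
weight `n`. -/
def basicSubgroup (R : Subgroup F) (x : α → F) (n : ℕ) : Subgroup F :=
  Subgroup.closure (commutatorEval x '' basicCommutators α n ∪ iteratedCommutator R (n - 1))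

theorem commutatorEval_mem_basicSubgroup (R : Subgroup F) (x : α → F) {w : FreeMagma α}
    (hw : IsBasicCommutator w) {n : ℕ} (hn : w.length = n) :
    commutatorEval x w ∈ basicSubgroup R x n :=
  Subgroup.subset_closure (Or.inl ⟨w, ⟨hw, hn⟩, rfl⟩)

theorem iteratedCommutator_le_basicSubgroup (R : Subgroup F) (x : α → F) (n : ℕ) :
    iteratedCommutator R n ≤ basicSubgroup R x (n + 1) :=
  fun _ h => Subgroup.subset_closure (Or.inr h)

theorem basicSubgroup_le (R : Subgroup F) [R.Normal] (x : α → F) (n : ℕ) :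
    basicSubgroup R x (n + 1) ≤ (⊤ : Subgroup F).lowerCentralSeries n := by
  refine (Subgroup.closure_le _).2 (Set.union_subset ?_ ?_)
  · rintro _ ⟨w, hw, rfl⟩
    exact commutatorEval_mem x w hw.2
  · exact (iteratedCommutator_le R n).trans inf_le_right

theorem basicSubgroup_normal {R : Subgroup F} [R.Normal] (hR : ⁅(⊤ : Subgroup F), ⊤⁆ ≤ R)
    (x : α → F) (n : ℕ) : (basicSubgroup R x (n + 1)).Normal :=
  Subgroup.commutator_top_right_le_iff.1 <|
    (Subgroup.commutator_mono (basicSubgroup_le R x n) le_rfl).trans <|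
      (lowerCentralSeries_succ_le_iteratedCommutator hR n).trans
        (iteratedCommutator_le_basicSubgroup R x n)

/-- If the brackets of `a` with the basic commutators of weight `m + 1` are combinations of basic
commutators, so are its brackets with all of `basicSubgroup R x (m + 1)`. -/
theorem commutator_basicSubgroup_zpowers_le {R : Subgroup F} [R.Normal]
    (hR : ⁅(⊤ : Subgroup F), ⊤⁆ ≤ R) (x : α → F) {a : FreeMagma α} {m n : ℕ}
    (hn : n = m + a.length)
    (h : ∀ w ∈ basicCommutators α (m + 1),
      ⁅commutatorEval x w, commutatorEval x a⁆ ∈ basicSubgroup R x (n + 1)) :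
    ⁅basicSubgroup R x (m + 1), Subgroup.zpowers (commutatorEval x a)⁆ ≤
      basicSubgroup R x (n + 1) := by
  have := basicSubgroup_normal hR x n
  obtain ⟨i, hi⟩ := Nat.exists_eq_add_one.2 a.length_pos
  rw [Subgroup.zpowers_eq_closure]
  refine Subgroup.commutator_closure_le ?_
  rintro s (⟨w, hw, rfl⟩ | hs) t ht
  · rw [Set.mem_singleton_iff.1 ht]
    exact h w hw
  · rw [Set.mem_singleton_iff.1 ht]
    apply iteratedCommutator_le_basicSubgroup
    have h := commutator_lowerCentralSeries_iteratedCommutator_le R i m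
    rw [Subgroup.commutator_comm] at h
    rw [show n = i + m + 1 by omega]
    exact h (Subgroup.commutator_mem_commutator hs (commutatorEval_mem x a hi))

/-- The bracket of two basic commutators is a combination of basic commutators. If
`[[a, b], v]` is not basic because `b > v`, the Jacobi identity replaces it by brackets
`[[b, v], a]` and `[[v, a], b]`; after rewriting the inner ones, these are brackets of basic
commutators which are both greater than `v`. -/
theorem commutatorElement_mem_basicSubgroup [Finite α]
    (hweight : ∀ a b : FreeMagma α, a.length < b.length → a < b)
    {R : Subgroup F} [R.Normal] (hR : ⁅(⊤ : Subgroup F), ⊤⁆ ≤ R) (x : α → F) (n : ℕ)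
    {u v : FreeMagma α} (hu : IsBasicCommutator u) (hv : IsBasicCommutator v)
    (huv : u.length + v.length = n) :
    ⁅commutatorEval x u, commutatorEval x v⁆ ∈ basicSubgroup R x n := by
  induction n using Nat.strong_induction_on generalizing u v with
  | _ n ih =>
  have : Finite {w : FreeMagma α // IsBasicCommutator w ∧ w.length < n} := by
    refine Set.Finite.subset ((Set.finite_lt_nat n).biUnion fun m _ =>
      basicCommutators_finite α m) fun w hw => ?_
    exact Set.mem_biUnion (x := w.length) hw.2 ⟨hw.1, rfl⟩
  have key : ∀ m : {w : FreeMagma α // IsBasicCommutator w ∧ w.length < n},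
      ∀ u v : FreeMagma α, IsBasicCommutator u → IsBasicCommutator v →
      u.length + v.length = n → min u v = m →
      ⁅commutatorEval x u, commutatorEval x v⁆ ∈ basicSubgroup R x n := by
    intro p
    induction p using WellFoundedGT.induction with
    | _ p ihp =>
    intro u v hu hv huv hmin
    wlog hlt : v < u generalizing u v
    · rcases (not_lt.1 hlt).lt_or_eq with h | h
      · rw [← commutatorElement_inv]
        exact Subgroup.inv_mem _ (this v u hv hu (by omega) (by rwa [min_comm]) h)
      · rw [h, commutatorElement_self]
        exact Subgroup.one_mem _
    rw [min_eq_right hlt.le] at hmin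
    by_cases hb : ∀ a b : FreeMagma α, u = a * b → b ≤ v
    · rw [← commutatorEval_mul]
      exact commutatorEval_mem_basicSubgroup R x (isBasicCommutator_mul.2 ⟨hu, hv, hlt, hb⟩) huv
    push Not at hb
    obtain ⟨a, b, rfl, hvb⟩ := hb
    obtain ⟨ha, hb, hba, -⟩ := isBasicCommutator_mul.1 hu
    rw [FreeMagma.length_mul'] at huv
    have hla := a.length_pos
    have hlb := b.length_pos
    obtain ⟨k, hk⟩ := Nat.exists_eq_add_one.2 v.length_pos
    obtain ⟨n, rfl⟩ : ∃ n', n = n' + 1 := ⟨n - 1, by omega⟩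
    have := basicSubgroup_normal hR x n
    -- the inner bracket has smaller weight, so it is a combination of basic commutators `w`
    have inner : ∀ y z : FreeMagma α, IsBasicCommutator y → IsBasicCommutator z → ∀ m,
        y.length + z.length = m + 1 → m < n →
        ⁅Subgroup.zpowers (commutatorEval x y), Subgroup.zpowers (commutatorEval x z)⁆ ≤
          basicSubgroup R x (m + 1) := by
      intro y z hy hz m hm hmn
      have := basicSubgroup_normal hR x m
      rw [Subgroup.zpowers_eq_closure, Subgroup.zpowers_eq_closure]
      refine Subgroup.commutator_closure_le fun s hs t ht => ?_
      rw [Set.mem_singleton_iff.1 hs, Set.mem_singleton_iff.1 ht]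
      exact ih (m + 1) (by omega) hy hz hm
    -- the outer bracket `[w, z]` has `w, z > v`
    have outer : ∀ z : FreeMagma α, IsBasicCommutator z → v < z → ∀ m, n = m + z.length →
        v.length < m + 1 → ∀ w ∈ basicCommutators α (m + 1),
        ⁅commutatorEval x w, commutatorEval x z⁆ ∈ basicSubgroup R x (n + 1) := by
      intro z hz hvz m hm hvm w hw
      have hvw : v < w := hweight v w (by rw [hw.2]; omega)
      have hlz := z.length_pos
      have hwl := hw.2
      refine ihp ⟨min w z, ?_⟩ ?_ w z hw.1 hz (by omega) rfl
      · rcases min_choice w z with h | h <;> rw [h]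
        · exact ⟨hw.1, by omega⟩
        · exact ⟨hz, by omega⟩
      · rw [← Subtype.coe_lt_coe, ← hmin]
        exact lt_min hvw hvz
    rw [commutatorEval_mul]
    have h3 : ⁅⁅Subgroup.zpowers (commutatorEval x a), Subgroup.zpowers (commutatorEval x b)⁆,
        Subgroup.zpowers (commutatorEval x v)⁆ ≤ basicSubgroup R x (n + 1) := by
      refine Subgroup.commutator_commutator_le_of_rotate ?_ ?_
      · refine (Subgroup.commutator_mono (inner b v hb hv (b.length + k) (by omega) (by omega))
          le_rfl).trans ?_
        exact commutator_basicSubgroup_zpowers_le hR x (by omega)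
          (outer a ha (hvb.trans hba) _ (by omega) (by omega))
      · refine (Subgroup.commutator_mono (inner v a hv ha (a.length + k) (by omega) (by omega))
          le_rfl).trans ?_
        exact commutator_basicSubgroup_zpowers_le hR x (by omega)
          (outer b hb hvb _ (by omega) (by omega))
    exact h3 (Subgroup.commutator_mem_commutator (Subgroup.commutator_mem_commutator
      (Subgroup.mem_zpowers _) (Subgroup.mem_zpowers _)) (Subgroup.mem_zpowers _))
  have hlu := u.length_pos
  have hlv := v.length_pos
  refine key ⟨min u v, ?_⟩ u v hu hv huv rfl
  rcases min_choice u v with h | h <;> rw [h]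
  · exact ⟨hu, by omega⟩
  · exact ⟨hv, by omega⟩

/-- The basic commutators of weight `n + 1` generate `γ_{n+1}(F)` modulo `[R, _n F]`, provided
that the letters generate `F` modulo `R ≥ γ_2(F)`. -/
theorem lowerCentralSeries_le_basicSubgroup [Finite α]
    (hweight : ∀ a b : FreeMagma α, a.length < b.length → a < b)
    {R : Subgroup F} [R.Normal] (hR : ⁅(⊤ : Subgroup F), ⊤⁆ ≤ R) (x : α → F)
    (hx : ∀ g : F, g ∈ Subgroup.closure (Set.range x ∪ R)) (n : ℕ) :
    (⊤ : Subgroup F).lowerCentralSeries n ≤ basicSubgroup R x (n + 1) := by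
  have h0 : ⊤ ≤ basicSubgroup R x 1 := by
    intro g _
    refine Subgroup.closure_mono (Set.union_subset_union_left _ ?_) (hx g)
    rintro _ ⟨i, rfl⟩
    exact ⟨FreeMagma.of i, ⟨isBasicCommutator_of i, rfl⟩, rfl⟩
  induction n with
  | zero => exact h0
  | succ n ih =>
    have := basicSubgroup_normal hR x (n + 1)
    refine (Subgroup.commutator_mono ih h0).trans (Subgroup.commutator_closure_le ?_)
    have hN : ∀ i j, n + 1 = i + j + 1 → ∀ s ∈ (⊤ : Subgroup F).lowerCentralSeries i,
        ∀ t ∈ iteratedCommutator R j, ⁅s, t⁆ ∈ basicSubgroup R x (n + 1 + 1) := by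
      intro i j hij s hs t ht
      apply iteratedCommutator_le_basicSubgroup
      rw [hij]
      exact commutator_lowerCentralSeries_iteratedCommutator_le R i j
        (Subgroup.commutator_mem_commutator hs ht)
    rintro s (⟨u, hu, rfl⟩ | hs) t (⟨v, hv, rfl⟩ | ht)
    · exact commutatorElement_mem_basicSubgroup hweight hR x _ hu.1 hv.1 (by rw [hu.2, hv.2])
    · exact hN n 0 rfl _ (commutatorEval_mem x u hu.2) t ht
    · rw [← commutatorElement_inv]
      exact Subgroup.inv_mem _ (hN 0 n (by omega) _ (Subgroup.mem_top _) s hs)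
    · exact hN n 0 rfl _ ((iteratedCommutator_le R n).trans inf_le_right hs) t ht

end

end Spanning

/-! ### The exponent of `γ_{c+1}(F) / [R, _c F]` -/

section Exponent

variable {F : Type u} [Group F]

theorem commutatorElement_pow_left_of_mem_center {g f : F} (h : ⁅g, f⁆ ∈ Subgroup.center F)
    (n : ℕ) : ⁅g ^ n, f⁆ = ⁅g, f⁆ ^ n := by
  induction n with
  | zero => simp
  | succ n ih =>
    rw [pow_succ, commutatorElement_mul_left_eq_conj_mul, ih,
      (Subgroup.mem_center_iff.1 h (g ^ n)), mul_inv_cancel_right, pow_succ']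

/-- If the generators `s ∈ S` are central modulo `K` and satisfy `s ^ n ∈ K`, so do all elements of
the subgroup generated by `S`. -/
theorem pow_mem_of_mem_closure {K : Subgroup F} [K.Normal] {S : Set F}
    (hS : ∀ s ∈ S, ∀ f : F, ⁅s, f⁆ ∈ K) {n : ℕ} (h : ∀ s ∈ S, s ^ n ∈ K) {g : F}
    (hg : g ∈ Subgroup.closure S) : g ^ n ∈ K := by
  have hc : ∀ s ∈ Subgroup.closure S, ∀ f : F, ⁅s, f⁆ ∈ K := by
    intro s hs f
    refine Subgroup.commutator_closure_le (T := Set.univ) (fun s hs t _ => hS s hs t) ?_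
    exact Subgroup.commutator_mem_commutator hs (Subgroup.subset_closure (Set.mem_univ f))
  simp only [← QuotientGroup.eq_one_iff, QuotientGroup.mk_pow] at h ⊢
  induction hg using Subgroup.closure_induction with
  | mem s hs => exact h s hs
  | one => simp
  | mul a b ha hb iha ihb =>
    have : Commute (a : F ⧸ K) (b : F ⧸ K) := by
      rw [← commutatorElement_eq_one_iff_commute]
      exact (QuotientGroup.eq_one_iff _).2 (hc a ha b)
    rw [QuotientGroup.mk_mul, this.mul_pow, iha, ihb, one_mul]
  | inv a ha iha => rw [QuotientGroup.mk_inv, inv_pow, iha, inv_one]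

theorem commutatorElement_pow_mem {K : Subgroup F} [K.Normal] {g f : F}
    (hc : ∀ t : F, ⁅⁅g, f⁆, t⁆ ∈ K) {n : ℕ} (h : ⁅g ^ n, f⁆ ∈ K) : ⁅g, f⁆ ^ n ∈ K := by
  rw [← QuotientGroup.eq_one_iff, QuotientGroup.mk_pow]
  have hcen : ⁅(g : F ⧸ K), (f : F ⧸ K)⁆ ∈ Subgroup.center (F ⧸ K) := by
    rw [Subgroup.mem_center_iff]
    rintro ⟨t⟩
    refine (commutatorElement_eq_one_iff_mul_comm.1 ?_).symm
    exact (QuotientGroup.eq_one_iff _).2 (hc t)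
  have h1 := commutatorElement_pow_left_of_mem_center hcen n
  have h2 : ⁅(g : F ⧸ K) ^ n, (f : F ⧸ K)⁆ = 1 := (QuotientGroup.eq_one_iff _).2 h
  rw [h2] at h1
  exact h1.symm

/-- A common exponent `n` of the generators `[x i, x j]` of `γ_2(F)` modulo `[R, F]` is an exponent
of `γ_{c+1}(F) / [R, _c F]` for all `c ≥ 1`, as `[g, f] ^ n = [g ^ n, f]` modulo `[R, _c F]`. -/
theorem pow_mem_iteratedCommutator {α : Type v} [Finite α] [LinearOrder (FreeMagma α)]
    (hweight : ∀ a b : FreeMagma α, a.length < b.length → a < b)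
    {R : Subgroup F} [R.Normal] (hR : ⁅(⊤ : Subgroup F), ⊤⁆ ≤ R) (x : α → F)
    (hx : ∀ g : F, g ∈ Subgroup.closure (Set.range x ∪ R)) {n : ℕ}
    (hn : ∀ i j, i ≠ j → ⁅x i, x j⁆ ^ n ∈ iteratedCommutator R 1) (c : ℕ) {g : F}
    (hg : g ∈ (⊤ : Subgroup F).lowerCentralSeries (c + 1)) :
    g ^ n ∈ iteratedCommutator R (c + 1) := by
  have central : ∀ c, ∀ s ∈ (⊤ : Subgroup F).lowerCentralSeries c, ∀ f : F,
      ⁅s, f⁆ ∈ iteratedCommutator R c := fun c s hs f =>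
    lowerCentralSeries_succ_le_iteratedCommutator hR c
      (Subgroup.commutator_mem_commutator hs (Subgroup.mem_top f))
  induction c generalizing g with
  | zero =>
    have hg' := lowerCentralSeries_le_basicSubgroup hweight hR x hx 1 hg
    refine pow_mem_of_mem_closure ?_ ?_ hg'
    · exact fun s hs => central 1 s (basicSubgroup_le R x 1 (Subgroup.subset_closure hs))
    rintro s (⟨w, hw, rfl⟩ | hs)
    · obtain ⟨hw1, hw2⟩ := hw
      cases w with
      | of i => exact absurd hw2 (by decide : (1 : ℕ) ≠ 2)
      | mul a b =>
        have ha := a.length_pos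
        have hb := b.length_pos
        change a.length + b.length = 2 at hw2
        cases a with
        | mul a a' =>
          have ha := a.length_pos
          have ha' := a'.length_pos
          change a.length + a'.length + b.length = 2 at hw2
          omega
        | of i =>
          cases b with
          | mul b b' =>
            have hb := b.length_pos
            have hb' := b'.length_pos
            change 1 + (b.length + b'.length) = 2 at hw2
            omega
          | of j =>
            refine hn i j ?_
            rintro rfl
            exact lt_irrefl _ hw1.2.2.1
    · exact Subgroup.pow_mem _ hs n
  | succ c ih =>
    refine pow_mem_of_mem_closure ?_ ?_ hg
    · exact fun s hs => central (c + 2) s (Subgroup.subset_closure hs)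
    rintro s ⟨g, hg, f, -, rfl⟩
    refine commutatorElement_pow_mem (fun t => central (c + 2) _
      (Subgroup.commutator_mem_commutator hg (Subgroup.mem_top f)) t) ?_
    exact Subgroup.commutator_mem_commutator (ih hg) (Subgroup.mem_top f)

end Exponent

/-! ### Lazard elimination for basic commutators -/

/-- The total weight of a sequence of bracketings. -/
def totalWeight {α : Type v} (l : List (FreeMagma α)) : ℕ := (l.map FreeMagma.length).sum

theorem totalWeight_cons {α : Type v} (u : FreeMagma α) (l : List (FreeMagma α)) :
    totalWeight (u :: l) = u.length + totalWeight l := by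
  simp [totalWeight]

section LieEval

variable {α : Type v} {A : Type*} [Ring A]

/-- The value in an associative ring of a formal bracketing, the letters being sent to the
elements `y i`. -/
def lieEval (y : α → A) : FreeMagma α → A
  | .of i => y i
  | .mul a b => ⁅lieEval y a, lieEval y b⁆

theorem lieEval_mul (y : α → A) (a b : FreeMagma α) :
    lieEval y (a * b) = lieEval y a * lieEval y b - lieEval y b * lieEval y a := rfl

/-- The product of the values of the members of a sequence of bracketings. -/
def lieProd (y : α → A) (l : List (FreeMagma α)) : A := (l.map (lieEval y)).prod

theorem lieProd_cons (y : α → A) (u : FreeMagma α) (l : List (FreeMagma α)) :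
    lieProd y (u :: l) = lieEval y u * lieProd y l := by
  simp [lieProd]

end LieEval

section Elimination

variable {α : Type v} [LinearOrder (FreeMagma α)]

/-- The letters that remain when the basic commutators in `D`, an initial segment, have been
eliminated one after the other: the basic commutators `u ∉ D` which are letters or of the form
`[a, b]` with `b ∈ D`. Eliminating `h` from a set `S` of letters means to replace `S` by
the set of all `[[u, h], …, h]` with `u ∈ S`, `u ≠ h`. -/
def remainingLetters (D : Set (FreeMagma α)) : Set (FreeMagma α) :=
  {u | IsBasicCommutator u ∧ u ∉ D ∧ ∀ a b : FreeMagma α, u = a * b → b ∈ D}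

/-- The sequences consisting of a word in the remaining letters, followed by a nonincreasing
sequence of elements of `D`. -/
def IsStandard (D : Set (FreeMagma α)) : List (FreeMagma α) → Prop
  | [] => True
  | u :: l => IsStandard D l ∧ (u ∈ remainingLetters D ∨ u ∈ D ∧ ∀ v ∈ l, v ≤ u)

theorem IsStandard.nil (D : Set (FreeMagma α)) : IsStandard D [] := trivial

theorem IsStandard.cons {D : Set (FreeMagma α)} {u : FreeMagma α} {l : List (FreeMagma α)}
    (hl : IsStandard D l) (hu : u ∈ remainingLetters D ∨ u ∈ D ∧ ∀ v ∈ l, v ≤ u) :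
    IsStandard D (u :: l) := ⟨hl, hu⟩

theorem IsStandard.forall_mem {D : Set (FreeMagma α)} {l : List (FreeMagma α)}
    (hl : IsStandard D l) : ∀ u ∈ l, u ∈ remainingLetters D ∨ u ∈ D := by
  induction l with
  | nil => simp
  | cons u l ih =>
    rintro v hv
    rcases List.mem_cons.1 hv with rfl | hv
    · exact hl.2.imp_right And.left
    · exact ih hl.1 v hv

variable {D : Set (FreeMagma α)} {h : FreeMagma α}

theorem lt_of_mem_remainingLetters_insert (hD : ∀ b, b ∈ D ↔ IsBasicCommutator b ∧ b < h)
    {t : FreeMagma α} (ht : t ∈ remainingLetters (insert h D)) : h < t := by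
  by_contra hlt
  rcases (not_lt.1 hlt).lt_or_eq with hlt | rfl
  · exact ht.2.1 (Or.inr ((hD t).2 ⟨ht.1, hlt⟩))
  · exact ht.2.1 (Or.inl rfl)

theorem mem_insert_of_le (hD : ∀ b, b ∈ D ↔ IsBasicCommutator b ∧ b < h) {b : FreeMagma α}
    (hb : IsBasicCommutator b) (hbh : b ≤ h) : b ∈ insert h D := by
  rcases hbh.lt_or_eq with hlt | rfl
  · exact Or.inr ((hD b).2 ⟨hb, hlt⟩)
  · exact Or.inl rfl

theorem le_of_mem_insert (hD : ∀ b, b ∈ D ↔ IsBasicCommutator b ∧ b < h) {b : FreeMagma α}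
    (hb : b ∈ insert h D) : b ≤ h := by
  rcases hb with rfl | hb
  · exact le_rfl
  · exact ((hD b).1 hb).2.le

theorem mem_remainingLetters_insert {u : FreeMagma α} (hu : u ∈ remainingLetters D)
    (huh : u ≠ h) : u ∈ remainingLetters (insert h D) :=
  ⟨hu.1, fun hmem => hmem.elim huh hu.2.1, fun a b hab => Or.inr (hu.2.2 a b hab)⟩

section Weight

variable (hweight : ∀ a b : FreeMagma α, a.length < b.length → a < b)
include hweight

theorem right_lt_mul (a b : FreeMagma α) : b < a * b :=
  hweight _ _ (by have := a.length_pos; rw [FreeMagma.length_mul']; omega)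

theorem self_mem_remainingLetters (hh : IsBasicCommutator h)
    (hD : ∀ b, b ∈ D ↔ IsBasicCommutator b ∧ b < h) : h ∈ remainingLetters D := by
  refine ⟨hh, fun hmem => lt_irrefl h ((hD h).1 hmem).2, ?_⟩
  rintro a b rfl
  exact (hD b).2 ⟨(isBasicCommutator_mul.1 hh).2.1, right_lt_mul hweight a b⟩

theorem mul_mem_remainingLetters_insert (hh : IsBasicCommutator h)
    (hD : ∀ b, b ∈ D ↔ IsBasicCommutator b ∧ b < h) {t : FreeMagma α}
    (ht : t ∈ remainingLetters (insert h D)) : t * h ∈ remainingLetters (insert h D) := by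
  refine ⟨isBasicCommutator_mul.2 ⟨ht.1, hh, lt_of_mem_remainingLetters_insert hD ht,
    fun a b hab => le_of_mem_insert hD (ht.2.2 a b hab)⟩, fun hmem => ?_, ?_⟩
  · exact (right_lt_mul hweight t h).not_ge (le_of_mem_insert hD hmem)
  · intro a b hab
    exact Or.inl (by injection hab with _ hb; exact hb.symm)

end Weight

theorem mem_remainingLetters_or_eq_mul (hD : ∀ b, b ∈ D ↔ IsBasicCommutator b ∧ b < h)
    {u : FreeMagma α} (hu : u ∈ remainingLetters (insert h D)) :
    u ∈ remainingLetters D ∨ ∃ t ∈ remainingLetters (insert h D), u = t * h := by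
  by_cases huD : ∀ a b : FreeMagma α, u = a * b → b ∈ D
  · exact Or.inl ⟨hu.1, fun hmem => hu.2.1 (Or.inr hmem), huD⟩
  push Not at huD
  obtain ⟨a, b, rfl, hb⟩ := huD
  obtain rfl : b = h := (hu.2.2 a b rfl).resolve_right hb
  obtain ⟨ha, -, hba, hab⟩ := isBasicCommutator_mul.1 hu.1
  refine Or.inr ⟨a, ⟨ha, fun hmem => hba.not_ge (le_of_mem_insert hD hmem), ?_⟩, rfl⟩
  rintro a' b' rfl
  exact mem_insert_of_le hD (isBasicCommutator_mul.1 ha).2.1 (hab a' b' rfl)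

/-- A standard sequence whose head is in `D` is a nonincreasing sequence in `D`, so it remains
standard when `h` is eliminated. -/
theorem IsStandard.insert_of_head_mem (hD : ∀ b, b ∈ D ↔ IsBasicCommutator b ∧ b < h)
    {u : FreeMagma α} {l : List (FreeMagma α)} (hl : IsStandard D l) (hu : u ∈ D)
    (hul : ∀ v ∈ l, v ≤ u) : IsStandard (insert h D) (u :: l) := by
  refine ⟨?_, Or.inr ⟨Or.inr hu, hul⟩⟩
  induction l generalizing u with
  | nil => trivial
  | cons v l ih =>
    have hvu := hul v (List.mem_cons_self ..)
    have hbv : IsBasicCommutator v :=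
      (hl.forall_mem v (List.mem_cons_self ..)).elim (fun h => h.1) fun h => ((hD v).1 h).1
    have hv : v ∈ D := (hD v).2 ⟨hbv, hvu.trans_lt ((hD u).1 hu).2⟩
    have hvl := hl.2.elim (fun hv' => absurd hv hv'.2.1) And.right
    exact ⟨ih hl.1 hv hvl, Or.inr ⟨Or.inr hv, hvl⟩⟩

/-- The converse of `IsStandard.insert_of_head_mem`. -/
theorem IsStandard.of_insert_of_head_mem (hD : ∀ b, b ∈ D ↔ IsBasicCommutator b ∧ b < h)
    {u : FreeMagma α} {l : List (FreeMagma α)} (hl : IsStandard (insert h D) l) (hu : u ∈ D)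
    (hul : ∀ v ∈ l, v ≤ u) : IsStandard D (u :: l) := by
  refine ⟨?_, Or.inr ⟨hu, hul⟩⟩
  induction l generalizing u with
  | nil => trivial
  | cons v l ih =>
    have hvh := (hul v (List.mem_cons_self ..)).trans_lt ((hD u).1 hu).2
    have hv : v ∈ D := (hl.forall_mem v (List.mem_cons_self ..)).elim
      (fun hv => absurd (lt_of_mem_remainingLetters_insert hD hv) hvh.not_gt)
      (fun hv => hv.resolve_left hvh.ne)
    have hvl := hl.2.elim (fun hv' => absurd (Or.inr hv) hv'.2.1) And.right
    exact ⟨ih hl.1 hv hvl, Or.inr ⟨hv, hvl⟩⟩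

section Count

/-- Rewriting of a sequence when `h` is eliminated: from right to left, every factor `h` which is
followed by some `t > h` is absorbed into it, `h, t` becoming `[t, h]`. -/
def absorb (h : FreeMagma α) : List (FreeMagma α) → List (FreeMagma α)
  | [] => []
  | u :: l =>
    match absorb h l with
    | [] => [u]
    | t :: m => if u = h ∧ h < t then (t * h) :: m else u :: t :: m

theorem absorb_cons_of_not {h u : FreeMagma α} {l : List (FreeMagma α)}
    (hu : u = h → ∀ t ∈ absorb h l, t ≤ h) : absorb h (u :: l) = u :: absorb h l := by
  rw [absorb]
  cases hl : absorb h l with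
  | nil => rfl
  | cons t m =>
    refine if_neg ?_
    rintro ⟨hu', ht⟩
    exact (hu hu' t (by rw [hl]; exact List.mem_cons_self ..)).not_gt ht

theorem absorb_cons_self {h t : FreeMagma α} {l m : List (FreeMagma α)}
    (hl : absorb h l = t :: m) (ht : h < t) : absorb h (h :: l) = (t * h) :: m := by
  rw [absorb, hl]
  exact if_pos ⟨rfl, ht⟩

theorem absorb_eq_self {l : List (FreeMagma α)} (hl : ∀ u ∈ l, u ≤ h) : absorb h l = l := by
  induction l with
  | nil => rfl
  | cons u l ih =>
    have ih := ih fun u hu => hl u (List.mem_cons_of_mem _ hu)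
    rw [absorb_cons_of_not, ih]
    rw [ih]
    exact fun _ t ht => hl t (List.mem_cons_of_mem _ ht)

theorem totalWeight_absorb (h : FreeMagma α) (l : List (FreeMagma α)) :
    totalWeight (absorb h l) = totalWeight l := by
  induction l with
  | nil => rfl
  | cons u l ih =>
    rw [absorb, totalWeight_cons, ← ih]
    split
    · next hl => rw [hl, totalWeight_cons]
    · next t m hl =>
      rw [hl]
      split
      · next hu =>
        rw [totalWeight_cons, totalWeight_cons, FreeMagma.length_mul', hu.1]
        omega
      · rw [totalWeight_cons]

theorem exists_absorb_eq (hweight : ∀ a b : FreeMagma α, a.length < b.length → a < b)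
    (hh : IsBasicCommutator h) (hD : ∀ b, b ∈ D ↔ IsBasicCommutator b ∧ b < h)
    (l : List (FreeMagma α)) (hl : IsStandard (insert h D) l) :
    ∃ l', IsStandard D l' ∧ absorb h l' = l := by
  induction hn : totalWeight l using Nat.strong_induction_on generalizing l with
  | _ n ih =>
  subst hn
  cases l with
  | nil => exact ⟨[], trivial, rfl⟩
  | cons u l =>
    have hlu := u.length_pos
    have hself := self_mem_remainingLetters hweight hh hD
    obtain ⟨hl, hu⟩ := hl
    obtain ⟨l', hl', rfl⟩ := ih (totalWeight l) (by rw [totalWeight_cons]; omega) l hl rfl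
    rcases hu with hu | ⟨rfl | hu, hul⟩
    · rcases mem_remainingLetters_or_eq_mul hD hu with huD | ⟨t, ht, rfl⟩
      · refine ⟨u :: l', ⟨hl', Or.inl huD⟩, absorb_cons_of_not fun hu' => ?_⟩
        exact absurd (Or.inl hu') hu.2.1
      · have hlh := h.length_pos
        obtain ⟨l₁, hl₁, h₁⟩ := ih (totalWeight (t :: absorb h l'))
          (by rw [totalWeight_cons, totalWeight_cons, FreeMagma.length_mul']; omega)
          _ (hl.cons (Or.inl ht)) rfl
        exact ⟨h :: l₁, ⟨hl₁, Or.inl hself⟩,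
          absorb_cons_self h₁ (lt_of_mem_remainingLetters_insert hD ht)⟩
    · exact ⟨u :: l', ⟨hl', Or.inl hself⟩, absorb_cons_of_not fun _ => hul⟩
    · have huh := ((hD u).1 hu).2.le
      refine ⟨_, hl.of_insert_of_head_mem hD hu hul, absorb_eq_self fun v hv => ?_⟩
      rcases List.mem_cons.1 hv with rfl | hv
      · exact huh
      · exact (hul v hv).trans huh

end Count

section Span

variable {k A : Type*} [CommRing k] [Ring A] [Algebra k A]

variable (k) in
/-- The span of the values of the standard sequences of total weight `n`. -/
def standardSpan (y : α → A) (D : Set (FreeMagma α)) (n : ℕ) : Submodule k A :=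
  Submodule.span k (lieProd y '' {l | IsStandard D l ∧ totalWeight l = n})

theorem lieProd_mem_standardSpan (y : α → A) {l : List (FreeMagma α)} (hl : IsStandard D l)
    {n : ℕ} (hn : totalWeight l = n) : lieProd y l ∈ standardSpan k y D n :=
  Submodule.subset_span ⟨l, ⟨hl, hn⟩, rfl⟩

/-- It suffices to check that left multiplication by `a` preserves spans on standard sequences. -/
theorem mul_mem_standardSpan (y : α → A) {D : Set (FreeMagma α)} {a b : A} {m n : ℕ}
    (ha : ∀ l, IsStandard D l → totalWeight l = n → a * lieProd y l ∈ standardSpan k y D (m + n))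
    (hb : b ∈ standardSpan k y D n) : a * b ∈ standardSpan k y D (m + n) := by
  induction hb using Submodule.span_induction with
  | mem b hb =>
    obtain ⟨l, hl, rfl⟩ := hb
    exact ha l hl.1 hl.2
  | zero => rw [mul_zero]; exact Submodule.zero_mem _
  | add b c _ _ hb hc => rw [mul_add]; exact Submodule.add_mem _ hb hc
  | smul r b _ hb => rw [mul_smul_comm]; exact Submodule.smul_mem _ r hb

theorem lieEval_mul_mem_standardSpan (y : α → A) {u : FreeMagma α}
    (hu : u ∈ remainingLetters D) {b : A} {n : ℕ} (hb : b ∈ standardSpan k y D n) :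
    lieEval y u * b ∈ standardSpan k y D (u.length + n) :=
  mul_mem_standardSpan y (fun l hl hn => by
    rw [← lieProd_cons]
    exact lieProd_mem_standardSpan y (hl.cons (Or.inl hu)) (by rw [totalWeight_cons, hn])) hb

/-- A factor `h` is moved to the right past the remaining letters by `h t = t h - [t, h]`. -/
theorem lieEval_self_mul_mem_standardSpan
    (hweight : ∀ a b : FreeMagma α, a.length < b.length → a < b)
    (hh : IsBasicCommutator h) (hD : ∀ b, b ∈ D ↔ IsBasicCommutator b ∧ b < h) (y : α → A)
    (l : List (FreeMagma α)) (hl : IsStandard (insert h D) l) :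
    lieEval y h * lieProd y l ∈ standardSpan k y (insert h D) (h.length + totalWeight l) := by
  have hcons : (∀ v ∈ l, v ≤ h) →
      lieEval y h * lieProd y l ∈
        standardSpan k y (insert h D) (h.length + totalWeight l) := by
    intro hle
    rw [← lieProd_cons]
    exact lieProd_mem_standardSpan y (hl.cons (Or.inr ⟨Or.inl rfl, hle⟩)) (totalWeight_cons ..)
  induction l with
  | nil => exact hcons (by simp)
  | cons v l ih =>
    rcases hl.2 with hv | ⟨hv, hvl⟩
    · have key : lieEval y h * lieProd y (v :: l) =
          lieEval y v * (lieEval y h * lieProd y l) - lieProd y ((v * h) :: l) := by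
        rw [lieProd_cons, lieProd_cons, lieEval_mul]
        noncomm_ring
      rw [key]
      refine Submodule.sub_mem _ ?_ ?_
      · rw [totalWeight_cons, Nat.add_left_comm]
        refine lieEval_mul_mem_standardSpan y hv (ih hl.1 fun hle => ?_)
        rw [← lieProd_cons]
        exact lieProd_mem_standardSpan y (hl.1.cons (Or.inr ⟨Or.inl rfl, hle⟩)) (totalWeight_cons ..)
      · refine lieProd_mem_standardSpan y
          (hl.1.cons (Or.inl (mul_mem_remainingLetters_insert hweight hh hD hv))) ?_
        rw [totalWeight_cons, totalWeight_cons, FreeMagma.length_mul']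
        omega
    · refine hcons fun w hw => ?_
      rcases List.mem_cons.1 hw with rfl | hw
      · exact le_of_mem_insert hD hv
      · exact (hvl w hw).trans (le_of_mem_insert hD hv)

theorem lieProd_mem_standardSpan_insert
    (hweight : ∀ a b : FreeMagma α, a.length < b.length → a < b)
    (hh : IsBasicCommutator h) (hD : ∀ b, b ∈ D ↔ IsBasicCommutator b ∧ b < h) (y : α → A)
    (l : List (FreeMagma α)) (hl : IsStandard D l) :
    lieProd y l ∈ standardSpan k y (insert h D) (totalWeight l) := by
  induction l with
  | nil => exact lieProd_mem_standardSpan y (IsStandard.nil _) rfl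
  | cons u l ih =>
    rcases hl.2 with hu | ⟨hu, hul⟩
    · rw [lieProd_cons, totalWeight_cons]
      by_cases huh : u = h
      · subst huh
        refine mul_mem_standardSpan y (fun l' hl' hn => ?_) (ih hl.1)
        rw [← hn]
        exact lieEval_self_mul_mem_standardSpan hweight hh hD y l' hl'
      · exact lieEval_mul_mem_standardSpan y (mem_remainingLetters_insert hu huh) (ih hl.1)
    · exact lieProd_mem_standardSpan y (hl.1.insert_of_head_mem hD hu hul) rfl

end Span

/-- Elimination of all members of a finite initial segment `D` of the basic commutators: the
products of standard sequences span all products of letters, and there are at most as many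
standard sequences as words, of each weight. -/
theorem standardSpan_and_embedding
    (hweight : ∀ a b : FreeMagma α, a.length < b.length → a < b)
    {k A : Type*} [CommRing k] [Ring A] [Algebra k A] (y : α → A) (n : ℕ)
    (D : Finset (FreeMagma α)) (hD : ∀ u ∈ D, IsBasicCommutator u)
    (hD' : ∀ u ∈ D, ∀ b, IsBasicCommutator b → b < u → b ∈ D) :
    standardSpan k y ∅ n ≤ standardSpan k y D n ∧
      Nonempty ({l : List (FreeMagma α) // IsStandard D l ∧ totalWeight l = n} ↪
        {l : List (FreeMagma α) // IsStandard ∅ l ∧ totalWeight l = n}) := by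
  induction D using Finset.induction_on_max with
  | empty =>
    rw [Finset.coe_empty]
    exact ⟨le_rfl, ⟨Function.Embedding.refl _⟩⟩
  | insert h D hlt ih =>
    have hh : IsBasicCommutator h := hD h (Finset.mem_insert_self h D)
    have hDh : ∀ b, b ∈ (D : Set (FreeMagma α)) ↔ IsBasicCommutator b ∧ b < h := by
      refine fun b => ⟨fun hb => ⟨hD b (Finset.mem_insert_of_mem hb), hlt b hb⟩, fun hb => ?_⟩
      exact (Finset.mem_insert.1 (hD' h (Finset.mem_insert_self h D) b hb.1 hb.2)).resolve_left
        hb.2.ne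
    obtain ⟨ihs, ⟨ihe⟩⟩ := ih (fun u hu => hD u (Finset.mem_insert_of_mem hu))
      fun u hu b hb hbu => (hDh b).2 ⟨hb, hbu.trans (hlt u hu)⟩
    rw [Finset.coe_insert]
    constructor
    · refine ihs.trans (Submodule.span_le.2 ?_)
      rintro _ ⟨l, ⟨hl, rfl⟩, rfl⟩
      exact lieProd_mem_standardSpan_insert hweight hh hDh y l hl
    · have hex : ∀ l : {l : List (FreeMagma α) // IsStandard (insert h (D : Set _)) l ∧
          totalWeight l = n}, ∃ l' : {l : List (FreeMagma α) // IsStandard D l ∧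
          totalWeight l = n}, absorb h l'.1 = l.1 := by
        rintro ⟨l, hl, hn⟩
        obtain ⟨l', hl', rfl⟩ := exists_absorb_eq hweight hh hDh l hl
        exact ⟨⟨l', hl', by rwa [totalWeight_absorb] at hn⟩, rfl⟩
      choose f hf using hex
      refine ⟨Function.Embedding.trans ⟨f, fun l₁ l₂ h₁₂ => Subtype.ext ?_⟩ ihe⟩
      rw [← hf l₁, ← hf l₂, h₁₂]

end Elimination

/-! ### Linear independence of basic Lie polynomials -/

section Independence

/-- The Orzech property in the form of a count: if vectors `w` span independent vectors `v`
which are at least as many and finite in number, then `w` is independent. -/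
theorem linearIndependent_of_span_le {k M ι κ : Type*} [CommRing k] [AddCommGroup M] [Module k M]
    [Finite κ] {v : κ → M} (hv : LinearIndependent k v) {w : ι → M} (e : ι ↪ κ)
    (h : Submodule.span k (Set.range v) ≤ Submodule.span k (Set.range w)) :
    LinearIndependent k w := by
  set T := Finsupp.linearCombination k w with hT
  set V := Submodule.span k (Set.range v)
  let g : V.comap T →ₗ[k] (κ →₀ k) :=
    hv.repr ∘ₗ (T.restrict (p := V.comap T) (q := V) fun _ hx => hx)
  have hg : Function.Surjective g := by
    refine (LinearIndependent.linearCombinationEquiv hv).symm.surjective.comp ?_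
    rintro ⟨z, hz⟩
    have hz' := h hz
    rw [← Finsupp.range_linearCombination] at hz'
    obtain ⟨c, hc⟩ := hz'
    exact ⟨⟨c, by rw [Submodule.mem_comap, hT, hc]; exact hz⟩, Subtype.ext hc⟩
  have hi : Function.Injective (Finsupp.lmapDomain k k e ∘ₗ (V.comap T).subtype) :=
    (Finsupp.mapDomain_injective e.injective).comp Subtype.val_injective
  have hinj := OrzechProperty.injective_of_surjective_of_injective _ g hi hg
  rw [linearIndependent_iff]
  intro c hc
  have hc' : c ∈ V.comap T := by
    rw [Submodule.mem_comap, hT, hc]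
    exact Submodule.zero_mem _
  have : (⟨c, hc'⟩ : V.comap T) = 0 := by
    apply hinj
    rw [map_zero]
    change hv.repr _ = 0
    rw [← map_zero hv.repr]
    exact congrArg hv.repr (Subtype.ext hc)
  exact congrArg Subtype.val this

variable {α : Type v} [LinearOrder (FreeMagma α)]

theorem IsStandard.exists_eq_map_of {l : List (FreeMagma α)} (hl : IsStandard ∅ l) :
    ∃ w : List α, l = w.map FreeMagma.of ∧ w.length = totalWeight l := by
  induction l with
  | nil => exact ⟨[], rfl, rfl⟩
  | cons u l ih =>
    obtain ⟨w, rfl, hw⟩ := ih hl.1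
    have hu := hl.2.resolve_right fun h => h.1
    cases u with
    | of i => exact ⟨i :: w, rfl, by rw [totalWeight_cons, ← hw, List.length_cons, add_comm]; rfl⟩
    | mul a b => exact absurd (hu.2.2 a b rfl) (Set.notMem_empty b)

/-- In the free associative algebra, the Lie polynomials given by the basic commutators of weight
`n` are linearly independent: they belong to a family of products which spans all words of
length `n` and has at most as many members. -/
theorem linearIndependent_lieEval [Finite α]
    (hweight : ∀ a b : FreeMagma α, a.length < b.length → a < b) (k : Type*) [CommRing k]
    (n : ℕ) :
    LinearIndependent k fun h : basicCommutators α n =>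
      lieEval (fun i => MonoidAlgebra.of k (FreeMonoid α) (FreeMonoid.of i)) (h : FreeMagma α) := by
  set y : α → MonoidAlgebra k (FreeMonoid α) :=
    fun i => MonoidAlgebra.of k (FreeMonoid α) (FreeMonoid.of i)
  have hfin : {u : FreeMagma α | IsBasicCommutator u ∧ u.length ≤ n}.Finite := by
    refine Set.Finite.subset ((Set.finite_le_nat n).biUnion fun m _ =>
      basicCommutators_finite α m) fun w hw => ?_
    exact Set.mem_biUnion (x := w.length) hw.2 ⟨hw.1, rfl⟩
  set D := hfin.toFinset
  have hD : ∀ u, u ∈ D ↔ IsBasicCommutator u ∧ u.length ≤ n := fun u => hfin.mem_toFinset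
  obtain ⟨hspan, ⟨e⟩⟩ := standardSpan_and_embedding hweight (k := k) y n D
    (fun u hu => ((hD u).1 hu).1) fun u hu b hb hbu => (hD b).2 ⟨hb, by
      by_contra hlt
      exact hbu.not_gt (hweight u b (lt_of_le_of_lt ((hD u).1 hu).2 (not_le.1 hlt)))⟩
  let W := {l : List (FreeMagma α) // IsStandard ∅ l ∧ totalWeight l = n}
  choose word hword hlen using fun l : W => l.2.1.exists_eq_map_of
  have hinj : Function.Injective word := fun l₁ l₂ h₁₂ =>
    Subtype.ext (by rw [hword l₁, hword l₂, h₁₂])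
  have : Finite W := by
    have : Finite {w : List α // w.length = n} := List.finite_length_eq α n
    exact Finite.of_injective (fun l : W => (⟨word l, (hlen l).trans l.2.2⟩ :
      {w : List α // w.length = n})) fun l₁ l₂ h₁₂ => hinj (congrArg Subtype.val h₁₂)
  have hprod : ∀ w : List α, lieProd y (w.map FreeMagma.of) =
      MonoidAlgebra.of k (FreeMonoid α) (FreeMonoid.ofList w) := by
    intro w
    induction w with
    | nil => exact (map_one _).symm
    | cons i w ih =>
      rw [List.map_cons, lieProd_cons, ih, FreeMonoid.ofList_cons, map_mul]
      rfl
  have hv : LinearIndependent k fun l : W => lieProd y l.1 := by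
    have h₁ : LinearIndependent k fun l : W =>
        (Finsupp.single (FreeMonoid.ofList (word l)) (1 : k)) :=
      (Finsupp.linearIndependent_single_one k (FreeMonoid α)).comp _
        (FreeMonoid.ofList.injective.comp hinj)
    have h₂ : ∀ l : W, lieProd y l.1 =
        MonoidAlgebra.of k (FreeMonoid α) (FreeMonoid.ofList (word l)) := fun l => by
      conv_lhs => rw [hword l]
      exact hprod (word l)
    simp only [h₂]
    exact LinearIndependent.of_comp (MonoidAlgebra.coeffLinearEquiv k).toLinearMap h₁
  have hw := linearIndependent_of_span_le hv
    (w := fun l : {l : List (FreeMagma α) // IsStandard D l ∧ totalWeight l = n} =>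
      lieProd y l.1) e (by
      rw [standardSpan, standardSpan, Set.image_eq_range, Set.image_eq_range] at hspan
      exact hspan)
  have hsingle : ∀ h : basicCommutators α n, IsStandard D [(h : FreeMagma α)] ∧
      totalWeight [(h : FreeMagma α)] = n := fun h =>
    ⟨(IsStandard.nil _).cons (Or.inr ⟨(hD h.1).2 ⟨h.2.1, h.2.2.le⟩, by simp⟩), by
      rw [totalWeight_cons, h.2.2]; rfl⟩
  have hcomp := hw.comp (fun h : basicCommutators α n => ⟨[h.1], hsingle h⟩) fun h₁ h₂ h₁₂ => by
    simpa [Subtype.ext_iff] using h₁₂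
  convert! hcomp using 2 with h
  simp [lieProd]

end Independence

/-! ### The filtration of the units of a power series ring -/

section Magnus

open PowerSeries

variable {A : Type v} [Ring A]

/-- The group of the units of `A⟦X⟧` which are congruent to `1` modulo `X ^ n`. -/
def congruenceUnits (A : Type v) [Ring A] (n : ℕ) : Subgroup A⟦X⟧ˣ where
  carrier := {u | ∃ w : A⟦X⟧, (u : A⟦X⟧) = 1 + X ^ n * w}
  one_mem' := ⟨0, by simp⟩
  mul_mem' := by
    rintro u v ⟨w, hw⟩ ⟨z, hz⟩
    refine ⟨w * v + z, ?_⟩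
    rw [Units.val_mul, hw, add_mul, one_mul, mul_add, mul_assoc, hz]
    abel
  inv_mem' := by
    rintro u ⟨w, hw⟩
    refine ⟨-(w * (u⁻¹ : A⟦X⟧ˣ)), ?_⟩
    have h : (u : A⟦X⟧) * (u⁻¹ : A⟦X⟧ˣ) = 1 := u.mul_inv
    rw [hw, add_mul, one_mul, mul_assoc] at h
    rw [mul_neg, ← sub_eq_add_neg]
    exact eq_sub_of_add_eq h

theorem coeff_eq_of_eq_one_add {n : ℕ} (hn : n ≠ 0) {u w : A⟦X⟧} (h : u = 1 + X ^ n * w) :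
    coeff n u = constantCoeff w := by
  rw [h, map_add, coeff_one, if_neg hn, zero_add]
  simpa using coeff_X_pow_mul w n 0

theorem coeff_eq_zero_of_mem_congruenceUnits {n : ℕ} (hn : n ≠ 0) {u : A⟦X⟧ˣ}
    (hu : u ∈ congruenceUnits A (n + 1)) : coeff n (u : A⟦X⟧) = 0 := by
  obtain ⟨w, hw⟩ := hu
  rw [coeff_eq_of_eq_one_add hn (w := X * w) (by rw [hw, pow_succ, mul_assoc])]
  simp

theorem mem_congruenceUnits_succ {n : ℕ} (hn : n ≠ 0) {u : A⟦X⟧ˣ}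
    (hu : u ∈ congruenceUnits A n) (h : coeff n (u : A⟦X⟧) = 0) :
    u ∈ congruenceUnits A (n + 1) := by
  obtain ⟨w, hw⟩ := hu
  rw [coeff_eq_of_eq_one_add hn hw] at h
  obtain ⟨z, rfl⟩ := X_dvd_iff.2 h
  exact ⟨z, by rw [hw, pow_succ, mul_assoc]⟩

theorem coeff_mul_of_mem_congruenceUnits {n : ℕ} (hn : n ≠ 0) {u v : A⟦X⟧ˣ}
    (hu : u ∈ congruenceUnits A n) (hv : v ∈ congruenceUnits A n) :
    coeff n ((u * v : A⟦X⟧ˣ) : A⟦X⟧) = coeff n (u : A⟦X⟧) + coeff n (v : A⟦X⟧) := by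
  obtain ⟨w, hw⟩ := hu
  obtain ⟨z, hz⟩ := hv
  have h : ((u * v : A⟦X⟧ˣ) : A⟦X⟧) = 1 + X ^ n * (w * (v : A⟦X⟧) + z) := by
    rw [Units.val_mul, hw, add_mul, one_mul, mul_add, mul_assoc, hz]
    abel
  rw [coeff_eq_of_eq_one_add hn h, coeff_eq_of_eq_one_add hn hw, coeff_eq_of_eq_one_add hn hz,
    map_add, map_mul, hz]
  simp [hn]

/-- With `u = 1 + U` and `v = 1 + V` this is the identity
`⁅u, v⁆ = u v (v u)⁻¹ = 1 + (U V - V U) (v u)⁻¹`. -/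
theorem commutatorElement_eq_one_add {i j : ℕ} {u v : A⟦X⟧ˣ} {w z : A⟦X⟧}
    (hw : (u : A⟦X⟧) = 1 + X ^ i * w) (hz : (v : A⟦X⟧) = 1 + X ^ j * z) :
    ((⁅u, v⁆ : A⟦X⟧ˣ) : A⟦X⟧) =
      1 + X ^ (i + j) * ((w * z - z * w) * (((v * u)⁻¹ : A⟦X⟧ˣ) : A⟦X⟧)) := by
  have h₁ : ⁅u, v⁆ = u * v * (v * u)⁻¹ := by
    rw [commutatorElement_def, mul_inv_rev, mul_assoc (u * v)]
  have h₂ : (u : A⟦X⟧) * (v : A⟦X⟧) = (v : A⟦X⟧) * (u : A⟦X⟧) + X ^ (i + j) * (w * z - z * w) := by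
    have e₁ : X ^ i * w * (X ^ j * z) = X ^ (i + j) * (w * z) := by
      rw [mul_assoc, ← mul_assoc w, ← X_pow_mul, pow_add]
      simp only [mul_assoc]
    have e₂ : X ^ j * z * (X ^ i * w) = X ^ (i + j) * (z * w) := by
      rw [mul_assoc, ← mul_assoc z, ← X_pow_mul, add_comm, pow_add]
      simp only [mul_assoc]
    rw [hw, hz, mul_sub, ← e₁, ← e₂]
    noncomm_ring
  rw [h₁, Units.val_mul, Units.val_mul, h₂, add_mul, ← Units.val_mul, Units.mul_inv, mul_assoc]

theorem commutator_congruenceUnits_le (i j : ℕ) :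
    ⁅congruenceUnits A i, congruenceUnits A j⁆ ≤ congruenceUnits A (i + j) := by
  rw [Subgroup.commutator_le]
  rintro u ⟨w, hw⟩ v ⟨z, hz⟩
  exact ⟨_, commutatorElement_eq_one_add hw hz⟩

theorem constantCoeff_unit_of_mem {i : ℕ} (hi : i ≠ 0) {u : A⟦X⟧ˣ}
    (hu : u ∈ congruenceUnits A i) : constantCoeff (u : A⟦X⟧) = 1 := by
  obtain ⟨w, hw⟩ := hu
  rw [hw]
  simp [hi]

theorem coeff_commutatorElement {i j : ℕ} (hi : i ≠ 0) (hj : j ≠ 0) {u v : A⟦X⟧ˣ}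
    (hu : u ∈ congruenceUnits A i) (hv : v ∈ congruenceUnits A j) :
    coeff (i + j) ((⁅u, v⁆ : A⟦X⟧ˣ) : A⟦X⟧) =
      ⁅coeff i (u : A⟦X⟧), coeff j (v : A⟦X⟧)⁆ := by
  have hvu : constantCoeff (((v * u)⁻¹ : A⟦X⟧ˣ) : A⟦X⟧) = 1 := by
    have h : constantCoeff (((v * u)⁻¹ : A⟦X⟧ˣ) : A⟦X⟧) *
        constantCoeff ((v * u : A⟦X⟧ˣ) : A⟦X⟧) = 1 := by
      rw [← map_mul, Units.inv_mul, map_one]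
    rwa [Units.val_mul, map_mul, constantCoeff_unit_of_mem hi hu, constantCoeff_unit_of_mem hj hv,
      one_mul, mul_one] at h
  obtain ⟨w, hw⟩ := hu
  obtain ⟨z, hz⟩ := hv
  rw [coeff_eq_of_eq_one_add (by omega) (commutatorElement_eq_one_add hw hz),
    coeff_eq_of_eq_one_add hi hw, coeff_eq_of_eq_one_add hj hz, map_mul, hvu, mul_one, map_sub,
    map_mul, map_mul, Ring.lie_def]

/-- The coefficient of `X ^ n` as a homomorphism on the units congruent to `1` modulo `X ^ n`. -/
noncomputable def coeffHom (A : Type v) [Ring A] {n : ℕ} (hn : n ≠ 0) :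
    congruenceUnits A n →* Multiplicative A where
  toFun u := Multiplicative.ofAdd (coeff n (u : A⟦X⟧ˣ).val)
  map_one' := by simp [coeff_one, hn]
  map_mul' u v := by
    rw [← ofAdd_add, ← coeff_mul_of_mem_congruenceUnits hn u.2 v.2]
    rfl

variable {F : Type u} [Group F]

theorem exists_magnusHom [IsFreeGroup F] (l : F →* Multiplicative A) :
    ∃ Φ : F →* A⟦X⟧ˣ, ∀ g, Φ g ∈ congruenceUnits A 1 ∧
      coeff 1 (Φ g : A⟦X⟧) = (l g).toAdd := by
  have hunit : ∀ a : A, ∃ u : congruenceUnits A 1, ((u : A⟦X⟧ˣ) : A⟦X⟧) = 1 + X ^ 1 * C a := by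
    intro a
    have h : IsUnit (1 + X ^ 1 * C a : A⟦X⟧) := by
      rw [isUnit_iff_constantCoeff]
      simp
    exact ⟨⟨h.unit, C a, h.unit_spec⟩, h.unit_spec⟩
  choose t ht using hunit
  let Ψ : F →* congruenceUnits A 1 :=
    IsFreeGroup.lift fun e => t (l (IsFreeGroup.of e)).toAdd
  have hΨ : (coeffHom A one_ne_zero).comp Ψ = l := by
    refine IsFreeGroup.ext_hom fun e => ?_
    rw [MonoidHom.comp_apply, IsFreeGroup.lift_of]
    refine Multiplicative.toAdd.injective ?_
    change coeff 1 _ = _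
    rw [coeff_eq_of_eq_one_add one_ne_zero (ht _), constantCoeff_C]
  refine ⟨(congruenceUnits A 1).subtype.comp Ψ, fun g => ⟨(Ψ g).2, ?_⟩⟩
  exact congrArg Multiplicative.toAdd (DFunLike.congr_fun hΨ g)

variable {Φ : F →* A⟦X⟧ˣ}

theorem iteratedCommutator_le_comap (hΦ : ∀ g, Φ g ∈ congruenceUnits A 1) {R : Subgroup F}
    {m : ℕ} (hR : R ≤ (congruenceUnits A m).comap Φ) (k : ℕ) :
    iteratedCommutator R k ≤ (congruenceUnits A (m + k)).comap Φ := by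
  induction k with
  | zero => exact hR
  | succ k ih =>
    rw [iteratedCommutator, ← Subgroup.map_le_iff_le_comap, Subgroup.map_commutator]
    refine (Subgroup.commutator_mono (Subgroup.map_le_iff_le_comap.2 ih) ?_).trans
      (commutator_congruenceUnits_le (m + k) 1)
    rintro _ ⟨g, -, rfl⟩
    exact hΦ g

theorem mem_congruenceUnits_of_mem_lowerCentralSeries (hΦ : ∀ g, Φ g ∈ congruenceUnits A 1)
    {k : ℕ} {g : F} (hg : g ∈ (⊤ : Subgroup F).lowerCentralSeries k) :
    Φ g ∈ congruenceUnits A (k + 1) := by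
  rw [← iteratedCommutator_top] at hg
  rw [add_comm]
  exact iteratedCommutator_le_comap hΦ (fun g _ => hΦ g) k hg

/-- The leading coefficient of the value of a group commutator is the corresponding Lie
polynomial. -/
theorem coeff_commutatorEval {α : Type*} (hΦ : ∀ g, Φ g ∈ congruenceUnits A 1) (x : α → F)
    (w : FreeMagma α) :
    coeff w.length (Φ (commutatorEval x w) : A⟦X⟧) =
      lieEval (fun i => coeff 1 (Φ (x i) : A⟦X⟧)) w := by
  have hmem : ∀ w : FreeMagma α, Φ (commutatorEval x w) ∈ congruenceUnits A w.length := by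
    intro w
    obtain ⟨k, hk⟩ := Nat.exists_eq_add_one.2 w.length_pos
    rw [hk]
    exact mem_congruenceUnits_of_mem_lowerCentralSeries hΦ (commutatorEval_mem x w hk)
  induction w with
  | ih1 i => rfl
  | ih2 a b iha ihb =>
    rw [commutatorEval_mul, map_commutatorElement, FreeMagma.length_mul',
      coeff_commutatorElement a.length_pos.ne' b.length_pos.ne' (hmem a) (hmem b), iha, ihb]
    rfl

end Magnus

/-! ### The Baer invariant of a direct sum of two cyclic groups -/

section BaerInvariant

variable {F : Type u} [Group F] {r s : ℕ}

theorem commutator_le_ker {G : Type*} [CommGroup G] (π : F →* G) :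
    ⁅(⊤ : Subgroup F), ⊤⁆ ≤ π.ker := by
  rw [Subgroup.commutator_le]
  intro g _ f _
  rw [MonoidHom.mem_ker, map_commutatorElement, commutatorElement_eq_one_iff_mul_comm, mul_comm]

theorem mem_closure_of_lift {π : F →* Multiplicative (ZMod r × ZMod s)} {x : Fin 2 → F}
    (h0 : π (x 0) = Multiplicative.ofAdd (1, 0)) (h1 : π (x 1) = Multiplicative.ofAdd (0, 1))
    (g : F) : g ∈ Subgroup.closure (Set.range x ∪ π.ker) := by
  obtain ⟨a, ha⟩ := ZMod.intCast_surjective (π g).toAdd.1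
  obtain ⟨b, hb⟩ := ZMod.intCast_surjective (π g).toAdd.2
  have hker : (x 0 ^ a * x 1 ^ b)⁻¹ * g ∈ π.ker := by
    rw [MonoidHom.mem_ker, map_mul, map_inv, inv_mul_eq_one, map_mul, map_zpow, map_zpow, h0, h1,
      ← ofAdd_zsmul, ← ofAdd_zsmul, ← ofAdd_add]
    refine Multiplicative.toAdd.injective (Prod.ext ?_ ?_)
    · simp [← ha]
    · simp [← hb]
  have hx : ∀ i, x i ∈ Subgroup.closure (Set.range x ∪ π.ker) := fun i =>
    Subgroup.subset_closure (Or.inl ⟨i, rfl⟩)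
  rw [← mul_inv_cancel_left (x 0 ^ a * x 1 ^ b) g]
  exact mul_mem (mul_mem (zpow_mem (hx 0) a) (zpow_mem (hx 1) b))
    (Subgroup.subset_closure (Or.inr hker))

theorem commutatorElement_pow_gcd_mem {π : F →* Multiplicative (ZMod r × ZMod s)} {x : Fin 2 → F}
    (h0 : π (x 0) = Multiplicative.ofAdd (1, 0)) (h1 : π (x 1) = Multiplicative.ofAdd (0, 1))
    (i j : Fin 2) (hij : i ≠ j) :
    ⁅x i, x j⁆ ^ Nat.gcd r s ∈ iteratedCommutator π.ker 1 := by
  have hpow : ∀ (g f : F) (n : ℕ), g ^ n ∈ π.ker → ⁅g, f⁆ ^ n ∈ iteratedCommutator π.ker 1 := by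
    intro g f n hg
    refine commutatorElement_pow_mem (fun t => ?_) ?_
    · exact Subgroup.commutator_mem_commutator (commutator_le_ker π
        (Subgroup.commutator_mem_commutator (Subgroup.mem_top g) (Subgroup.mem_top f)))
        (Subgroup.mem_top t)
    · exact Subgroup.commutator_mem_commutator hg (Subgroup.mem_top f)
  have hr : x 0 ^ r ∈ π.ker := by
    rw [MonoidHom.mem_ker, map_pow, h0, ← ofAdd_nsmul]
    exact Multiplicative.toAdd.injective (by simp)
  have hs : x 1 ^ s ∈ π.ker := by
    rw [MonoidHom.mem_ker, map_pow, h1, ← ofAdd_nsmul]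
    exact Multiplicative.toAdd.injective (by simp)
  have hgcd : ⁅x 0, x 1⁆ ^ Nat.gcd r s ∈ iteratedCommutator π.ker 1 := by
    have hr' := hpow _ (x 1) r hr
    have hs' := inv_mem (hpow _ (x 0) s hs)
    rw [← inv_pow, commutatorElement_inv] at hs'
    rw [← QuotientGroup.eq_one_iff, QuotientGroup.mk_pow] at hr' hs' ⊢
    exact pow_gcd_eq_one.2 ⟨hr', hs'⟩
  fin_cases i <;> fin_cases j
  · exact absurd rfl hij
  · exact hgcd
  · change ⁅x 1, x 0⁆ ^ _ ∈ _
    rw [← commutatorElement_inv, inv_pow]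
    exact inv_mem hgcd
  · exact absurd rfl hij

theorem exists_hom_toAdd_eq (r s : ℕ) {A : Type*} [AddCommGroup A] [Module (ZMod (Nat.gcd r s)) A]
    (y : Fin 2 → A) : ∃ l : Multiplicative (ZMod r × ZMod s) →* Multiplicative A,
      (l (Multiplicative.ofAdd (1, 0))).toAdd = y 0 ∧
      (l (Multiplicative.ofAdd (0, 1))).toAdd = y 1 := by
  let f (n : ℕ) (hn : Nat.gcd r s ∣ n) (a : A) : ZMod n →+ A :=
    (LinearMap.toSpanSingleton (ZMod (Nat.gcd r s)) A a).toAddMonoidHom.comp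
      (ZMod.castHom hn (ZMod (Nat.gcd r s))).toAddMonoidHom
  have hf : ∀ n hn a, f n hn a 1 = a := by
    intro n hn a
    change (ZMod.castHom hn (ZMod (Nat.gcd r s))) 1 • a = a
    rw [map_one, one_smul]
  refine ⟨AddMonoidHom.toMultiplicative ((f r (Nat.gcd_dvd_left r s) (y 0)).coprod
    (f s (Nat.gcd_dvd_right r s) (y 1))), ?_, ?_⟩
  · change f r _ (y 0) 1 + f s _ (y 1) 0 = y 0
    rw [hf, map_zero, add_zero]
  · change f r _ (y 0) 0 + f s _ (y 1) 1 = y 1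
    rw [hf, map_zero, zero_add]

/-- A group of exponent `n` generated by commuting elements `b i` is free on them over `ZMod n`,
as soon as some homomorphism to a module sends them to linearly independent vectors. -/
theorem nonempty_mulEquiv_of_linearIndependent {Q : Type*} [Group Q] {n : ℕ} [NeZero n]
    (hcomm : ∀ p q : Q, p * q = q * p) (hexp : ∀ q : Q, q ^ n = 1) {ι : Type*} [Finite ι]
    (b : ι → Q) (hgen : ∀ q, q ∈ Subgroup.closure (Set.range b)) {A : Type*} [AddCommGroup A]
    [Module (ZMod n) A] (Θ : Q →* Multiplicative A)
    (hind : LinearIndependent (ZMod n) fun i => (Θ (b i)).toAdd) :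
    Nonempty (Q ≃* Multiplicative (Fin (Nat.card ι) → ZMod n)) := by
  let _ : CommGroup Q := { (inferInstance : Group Q) with mul_comm := hcomm }
  let _ : Module (ZMod n) (Additive Q) := AddCommGroup.zmodModule (n := n) hexp
  let b' : ι → Additive Q := fun i => Additive.ofMul (b i)
  have hspan : ⊤ ≤ Submodule.span (ZMod n) (Set.range b') := by
    intro q _
    have key : ∀ q : Q, Additive.ofMul q ∈ Submodule.span (ZMod n) (Set.range b') := by
      intro q
      induction hgen q using Subgroup.closure_induction with
      | mem q hq =>
        obtain ⟨i, rfl⟩ := hq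
        exact Submodule.subset_span ⟨i, rfl⟩
      | one => exact Submodule.zero_mem _
      | mul p q _ _ hp hq => exact Submodule.add_mem _ hp hq
      | inv q _ hq => exact Submodule.neg_mem _ hq
    exact key q.toMul
  let θ : Additive Q →ₗ[ZMod n] A := AddMonoidHom.toZModLinearMap n (MonoidHom.toAdditiveLeft Θ)
  have hind' : LinearIndependent (ZMod n) b' := LinearIndependent.of_comp θ hind
  let e := ((Module.Basis.mk hind' hspan).reindex (Finite.equivFin ι)).equivFun.toAddEquiv
  exact ⟨AddEquiv.toMultiplicativeRight e⟩

end BaerInvariant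

theorem theorem1 (c r s : ℕ) (hc : 1 ≤ c) (hr : 0 < r) (hs : 0 < s)
    {F : Type u} [Group F] [IsFreeGroup F]
    (π : F →* Multiplicative (ZMod r × ZMod s)) (hπ : Function.Surjective π)
    [LinearOrder (FreeMagma (Fin 2))]
    (hweight : ∀ a b : FreeMagma (Fin 2), a.length < b.length → a < b) :
    Nonempty (NilpotentBaerInvariant c π ≃*
      Multiplicative (Fin (basicCommutators (Fin 2) (c + 1)).ncard → ZMod (Nat.gcd r s))) := by
  have : NeZero (Nat.gcd r s) := ⟨(Nat.gcd_pos_of_pos_left s hr).ne'⟩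
  have hR := commutator_le_ker π
  obtain ⟨x₀, h0⟩ := hπ (Multiplicative.ofAdd (1, 0))
  obtain ⟨x₁, h1⟩ := hπ (Multiplicative.ofAdd (0, 1))
  let x : Fin 2 → F := ![x₀, x₁]
  replace h0 : π (x 0) = _ := h0
  replace h1 : π (x 1) = _ := h1
  have hgen := mem_closure_of_lift h0 h1
  have hle : (⊤ : Subgroup F).lowerCentralSeries c ≤ π.ker :=
    (Subgroup.lowerCentralSeries_antitone _ hc).trans hR
  -- the Baer invariant is an abelian group of exponent `gcd r s`
  have hcomm : ∀ p q : NilpotentBaerInvariant c π, p * q = q * p := by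
    intro p q
    obtain ⟨a, rfl⟩ := QuotientGroup.mk_surjective p
    obtain ⟨b, rfl⟩ := QuotientGroup.mk_surjective q
    rw [← commutatorElement_eq_one_iff_mul_comm]
    refine (QuotientGroup.eq_one_iff ⁅a, b⁆).2 (Subgroup.mem_subgroupOf.2 ?_)
    exact lowerCentralSeries_succ_le_iteratedCommutator hR c
      (Subgroup.commutator_mem_commutator a.2.2 (Subgroup.mem_top (b : F)))
  have hexp : ∀ q : NilpotentBaerInvariant c π, q ^ Nat.gcd r s = 1 := by
    intro q
    obtain ⟨a, rfl⟩ := QuotientGroup.mk_surjective q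
    refine (QuotientGroup.eq_one_iff (a ^ Nat.gcd r s)).2 (Subgroup.mem_subgroupOf.2 ?_)
    obtain ⟨c, rfl⟩ := Nat.exists_eq_add_of_le' hc
    exact pow_mem_iteratedCommutator hweight hR x hgen
      (commutatorElement_pow_gcd_mem h0 h1) c a.2.2
  have hmem : ∀ g ∈ (⊤ : Subgroup F).lowerCentralSeries c,
      g ∈ π.ker ⊓ (⊤ : Subgroup F).lowerCentralSeries c := fun g hg => ⟨hle hg, hg⟩
  let b : basicCommutators (Fin 2) (c + 1) → NilpotentBaerInvariant c π := fun h =>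
    QuotientGroup.mk ⟨commutatorEval x h.1, hmem _ (commutatorEval_mem x h.1 h.2.2)⟩
  have hb : ∀ q, q ∈ Subgroup.closure (Set.range b) := by
    have key : ∀ g ∈ basicSubgroup π.ker x (c + 1),
        ∀ hg : g ∈ π.ker ⊓ (⊤ : Subgroup F).lowerCentralSeries c,
        (QuotientGroup.mk ⟨g, hg⟩ : NilpotentBaerInvariant c π) ∈
          Subgroup.closure (Set.range b) := by
      intro g hg
      have hlcs := fun a (ha : a ∈ basicSubgroup π.ker x (c + 1)) =>
        hmem a (basicSubgroup_le π.ker x c ha)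
      induction hg using Subgroup.closure_induction with
      | mem g hg =>
        intro hg'
        rcases hg with ⟨h, hh, rfl⟩ | hg
        · exact Subgroup.subset_closure ⟨⟨h, hh⟩, rfl⟩
        · have : (QuotientGroup.mk ⟨g, hg'⟩ : NilpotentBaerInvariant c π) = 1 :=
            (QuotientGroup.eq_one_iff _).2 (Subgroup.mem_subgroupOf.2 hg)
          rw [this]
          exact Subgroup.one_mem _
      | one => exact fun _ => Subgroup.one_mem _
      | mul g f hg hf ihg ihf =>
        exact fun _ => Subgroup.mul_mem _ (ihg (hlcs g hg)) (ihf (hlcs f hf))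
      | inv g hg ihg => exact fun _ => Subgroup.inv_mem _ (ihg (hlcs g hg))
    intro q
    obtain ⟨a, rfl⟩ := QuotientGroup.mk_surjective q
    exact key a.1 (lowerCentralSeries_le_basicSubgroup hweight hR x hgen c a.2.2) a.2
  -- a Magnus expansion of `F` whose linear part factors through `π`
  let y : Fin 2 → MonoidAlgebra (ZMod (Nat.gcd r s)) (FreeMonoid (Fin 2)) :=
    fun i => MonoidAlgebra.of _ _ (FreeMonoid.of i)
  obtain ⟨l, hl0, hl1⟩ := exists_hom_toAdd_eq r s y
  obtain ⟨Φ, hΦ⟩ := exists_magnusHom (l.comp π)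
  have hΦ1 := fun g => (hΦ g).1
  have hy : (fun i => PowerSeries.coeff 1 (Φ (x i)).val) = y := by
    funext i
    rw [(hΦ (x i)).2, MonoidHom.comp_apply]
    fin_cases i
    · exact (congrArg (fun g => (l g).toAdd) h0).trans hl0
    · exact (congrArg (fun g => (l g).toAdd) h1).trans hl1
  have hker : π.ker ≤ (congruenceUnits _ 2).comap Φ := by
    intro g hg
    refine mem_congruenceUnits_succ one_ne_zero (hΦ1 g) ?_
    rw [(hΦ g).2, MonoidHom.comp_apply, MonoidHom.mem_ker.1 hg, map_one, toAdd_one]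
  let Θ : NilpotentBaerInvariant c π →*
      Multiplicative (MonoidAlgebra (ZMod (Nat.gcd r s)) (FreeMonoid (Fin 2))) :=
    QuotientGroup.lift _ ((coeffHom _ c.succ_ne_zero).comp
      ((Φ.comp (Subgroup.subtype _)).codRestrict (congruenceUnits _ (c + 1)) fun g =>
        mem_congruenceUnits_of_mem_lowerCentralSeries hΦ1 g.2.2)) (by
      intro g hg
      have h := iteratedCommutator_le_comap hΦ1 hker c (Subgroup.mem_subgroupOf.1 hg)
      rw [show 2 + c = c + 1 + 1 by omega] at h
      have h' := coeff_eq_zero_of_mem_congruenceUnits c.succ_ne_zero h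
      exact congrArg Multiplicative.ofAdd h')
  have hΘ : ∀ h, (Θ (b h)).toAdd = lieEval y h.1 := by
    intro h
    rw [← hy, ← coeff_commutatorEval hΦ1 x h.1, h.2.2]
    rfl
  have hfin : Finite (basicCommutators (Fin 2) (c + 1)) := basicCommutators_finite _ _
  refine nonempty_mulEquiv_of_linearIndependent hcomm hexp b hb Θ ?_
  simp only [hΘ]
  exact linearIndependent_lieEval hweight (ZMod (Nat.gcd r s)) (c + 1)
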